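/- Let $\mathcal Y \subset \mathbb R$ be a bounded interval, and let $\mu, \nu$ be probability measures on $\mathcal Y$ that are absolutely continuous with respect to Lebesgue measure with densities strictly positive on $\mathcal Y$. Let $F, G$ be the distribution functions of $\mu,\nu$ and let $F^{-1}(u) = \inf\{y : F(y)\ge u\}$, $G^{-1}(u) = \inf\{y : G(y)\ge u\}$ be their quantile functions. Let $\rho \in (0,1)$, $\epsilon(\rho) = (1-\rho)/\rho$, and let $\Pi(\mu,\nu)$ be the set of couplings of $\mu$ and $\nu$. For $\pi\in\Pi(\mu,\nu)$ put $$\mathsf R(\pi) = \tfrac12\, \mathbb E_{(Y_0,Y_1)\sim\pi}\,\mathbb E_{(Y_0',Y_1')\sim\pi}\,(Y_0-Y_0')(Y_1-Y_1'),$$ where $(Y_0,Y_1)$ and $(Y_0',Y_1')$ are independent draws from $\pi$. Then the functional $$\pi \mapsto \mathsf R(\pi) - \epsilon(\rho)\,\mathsf{KL}(\pi \mid \mu\otimes\nu)$$ has a unique maximizer $\pi_\rho$ over $\Pi(\mu,\nu)$. For $(Y_0,Y_1)\sim\pi_\rho$, the conditional law of $Y_1$ given $Y_0 = y_0$ has a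 version that is weakly continuous in $y_0\in\mathcal Y$, and this version is unique at every $y_0 \in \mathcal Y$. With conditional probabilities given by this version, for every $u\in(0,1)$ one has $F^{-1}(u) \in \mathcal Y$ and $$\mathbb P\bigl(Y_1 \ne G^{-1}(u) \,\big|\, Y_0 = F^{-1}(u)\bigr) > 0.$$ In particular rank violations occur with positive probability: $\mathbb P\bigl(Y_1 \ne G^{-1}(F(Y_0))\bigr) > 0$. -/

import Mathlib

open MeasureTheory ProbabilityTheory InformationTheory
open scoped ENNReal BoundedContinuousFunction

noncomputable section

/-- `μ` lives on `S`, is absolutely continuous with respect to Lebesgue measure, and has a density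
that is strictly positive on `S`. -/
def HasPositiveDensityOn (S : Set ℝ) (μ : Measure ℝ) : Prop :=
  ∃ f : ℝ → ℝ, Measurable f ∧ (∀ y ∈ S, 0 < f y) ∧
    μ = (volume.restrict S).withDensity (fun y => ENNReal.ofReal (f y))

/-- The quantile function `u ↦ inf {y | u ≤ F y}` of the distribution function `F` of `μ`. -/
def quantileFn (μ : Measure ℝ) (u : ℝ) : ℝ :=
  sInf {y : ℝ | u ≤ cdf μ y}

/-- `Π(μ, ν)`: measures on the plane with first marginal `μ` and second marginal `ν`. -/
def couplings (μ ν : Measure ℝ) : Set (Measure (ℝ × ℝ)) :=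
  {π | π.fst = μ ∧ π.snd = ν}

/-- Average rank preservation `(1/2) E E' (Y₀ - Y₀') (Y₁ - Y₁')`, where `(Y₀, Y₁)` and `(Y₀', Y₁')`
are independent draws from `π`. -/
def avgRank (π : Measure (ℝ × ℝ)) : ℝ :=
  (1 / 2) * ∫ p, ∫ q, (p.1 - q.1) * (p.2 - q.2) ∂π ∂π

/-- The regularization strength `ε(ρ) = (1 - ρ) / ρ`. -/
def stickinessEps (ρ : ℝ) : ℝ := (1 - ρ) / ρ

/-- The objective `R(π) - ε(ρ) KL(π | μ ⊗ ν)`; it is `-∞` where the divergence is infinite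
(for `0 < ρ < 1`). -/
def rankObjective (μ ν : Measure ℝ) (ρ : ℝ) (π : Measure (ℝ × ℝ)) : EReal :=
  (avgRank π : EReal) - (stickinessEps ρ : EReal) * (klDiv π (μ.prod ν) : EReal)

/-- `π` maximizes `R(π) - ε(ρ) KL(π | μ ⊗ ν)` over the couplings of `μ` and `ν`. -/
def IsRankMaximizer (μ ν : Measure ℝ) (ρ : ℝ) (π : Measure (ℝ × ℝ)) : Prop :=
  π ∈ couplings μ ν ∧ IsMaxOn (rankObjective μ ν ρ) (couplings μ ν) π

/-- `κ` is a continuous version on `S` of the conditional law of `Y₁` given `Y₀` for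
`(Y₀, Y₁) ∼ π`: a regular conditional distribution `y₀ ↦ κ y₀` that is continuous on `S` for weak
convergence of probability measures. -/
structure IsContinuousCondLaw (S : Set ℝ) (π : Measure (ℝ × ℝ)) (κ : Kernel ℝ ℝ) : Prop where
  isMarkov : IsMarkovKernel κ
  isCond : π.IsCondKernel κ
  continuousOn : ∀ h : ℝ →ᵇ ℝ, ContinuousOn (fun y₀ => ∫ y₁, h y₁ ∂(κ y₀)) S

end

/-! On couplings of `μ` and `ν`, average rank preservation is the covariance, that is `∫ x y dπ`
minus a constant, so the problem is entropic optimal transport with kernel `c = x y / ε`. If bounded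
continuous potentials `f`, `g` make `exp (f + g + c)` a density of a coupling `Q` with respect to `μ
⊗ ν`, the objective equals a constant minus `ε KL(π | Q)`, so `Q` is the only maximizer
(`isRankMaximizer_tilted_unique`). The potentials are a fixed point of Sinkhorn's iteration, which
contracts the oscillation seminorm (`softTransform_oscillation`, `exists_schrodinger_potentials`).

The normalization of `exp (f + g + c)` holds at every `x`, so it defines a conditional law with
density relative to `ν`, weakly continuous in `x`. Since `ν` has no atoms, this law charges no
single point, and a rank violation has conditional probability one everywhere. Continuity and the
positive density of `μ` fix the version on `S` (`IsContinuousCondLaw.apply_eq`). -/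

/-- Writing `r' = exp (m + t)` with `0 ≤ t ≤ D`, convexity of `exp` turns the lower bound on `r`
into `r ≥ exp (m + θ t)`, so the logarithms differ by at most `(1 - θ) t`. -/
theorem log_sub_log_le_of_doeblin {θ D m r r' : ℝ} (hθ : 0 ≤ θ) (hθ1 : θ ≤ 1)
    (h1 : Real.exp m ≤ r') (h2 : r' ≤ Real.exp (m + D))
    (h : Real.exp m + θ * (r' - Real.exp m) ≤ r) :
    Real.log r' - Real.log r ≤ (1 - θ) * D := by
  have hr' : 0 < r' := (Real.exp_pos m).trans_le h1
  have hr : 0 < r := by nlinarith [Real.exp_pos m]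
  set t := Real.log r' - m with ht
  have ht0 : 0 ≤ t := by
    rw [ht, sub_nonneg, Real.le_log_iff_exp_le hr']; exact h1
  have htD : t ≤ D := by
    rw [ht, sub_le_iff_le_add', Real.log_le_iff_le_exp hr']; exact h2
  have hre : r' = Real.exp m * Real.exp t := by
    rw [← Real.exp_add, ht, add_sub_cancel, Real.exp_log hr']
  have hconv : Real.exp (θ * t) ≤ (1 - θ) + θ * Real.exp t := by
    have := convexOn_exp.2 (Set.mem_univ (0 : ℝ)) (Set.mem_univ t) (sub_nonneg.2 hθ1) hθ
      (by ring)
    simpa using this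
  have hlow : Real.exp (m + θ * t) ≤ r := by
    rw [Real.exp_add]
    refine le_trans (mul_le_mul_of_nonneg_left hconv (Real.exp_pos m).le) (le_trans (le_of_eq ?_) h)
    rw [hre]; ring
  have := (Real.le_log_iff_exp_le hr).2 hlow
  nlinarith [mul_le_mul_of_nonneg_left htD (sub_nonneg.2 hθ1)]

/-! ### Soft transforms, Sinkhorn contraction and Schrödinger potentials. -/

section Schrodinger

variable {X Y : Type*} [TopologicalSpace X] [TopologicalSpace Y]

theorem continuous_exp_add_kernel (c : (X × Y) →ᵇ ℝ) (g : Y →ᵇ ℝ) (x : X) :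
    Continuous fun y => Real.exp (g y + c (x, y)) := by fun_prop

theorem add_kernel_mem_Icc (c : (X × Y) →ᵇ ℝ) (g : Y →ᵇ ℝ) (x : X) (y : Y) :
    g y + c (x, y) ∈ Set.Icc (-(‖g‖ + ‖c‖)) (‖g‖ + ‖c‖) := by
  have h1 := abs_le.1 (g.norm_coe_le_norm y)
  have h2 := abs_le.1 (c.norm_coe_le_norm (x, y))
  constructor <;> linarith [h1.1, h1.2, h2.1, h2.2]

/-- The kernel with its two arguments exchanged. -/
def swapKernel (c : (X × Y) →ᵇ ℝ) : (Y × X) →ᵇ ℝ :=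
  c.compContinuous ⟨Prod.swap, continuous_swap⟩

@[simp]
theorem swapKernel_apply (c : (X × Y) →ᵇ ℝ) (y : Y) (x : X) : swapKernel c (y, x) = c (x, y) := rfl

variable [MeasurableSpace Y] [OpensMeasurableSpace Y]

theorem integrable_exp_add_kernel (ν : Measure Y) [IsFiniteMeasure ν] (c : (X × Y) →ᵇ ℝ)
    (g : Y →ᵇ ℝ) (x : X) : Integrable (fun y => Real.exp (g y + c (x, y))) ν := by
  refine Integrable.of_bound (continuous_exp_add_kernel c g x).aestronglyMeasurable
    (Real.exp (‖g‖ + ‖c‖)) (ae_of_all _ fun y => ?_)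
  rw [Real.norm_eq_abs, Real.abs_exp, Real.exp_le_exp]
  exact (add_kernel_mem_Icc c g x y).2

/-- The partition function `x ↦ ∫ exp (g y + c (x, y)) dν(y)`. -/
noncomputable def partitionFn (ν : Measure Y) (c : (X × Y) →ᵇ ℝ) (g : Y → ℝ) (x : X) : ℝ :=
  ∫ y, Real.exp (g y + c (x, y)) ∂ν

theorem partitionFn_mem_Icc (ν : Measure Y) [IsProbabilityMeasure ν] (c : (X × Y) →ᵇ ℝ)
    (g : Y →ᵇ ℝ) (x : X) :
    partitionFn ν c g x ∈ Set.Icc (Real.exp (-(‖g‖ + ‖c‖))) (Real.exp (‖g‖ + ‖c‖)) := by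
  have hi := integrable_exp_add_kernel ν c g x
  constructor
  · calc Real.exp (-(‖g‖ + ‖c‖)) = ∫ _, Real.exp (-(‖g‖ + ‖c‖)) ∂ν := by simp
      _ ≤ _ := integral_mono (integrable_const _) hi fun y =>
        Real.exp_le_exp.2 (add_kernel_mem_Icc c g x y).1
  · calc partitionFn ν c g x ≤ ∫ _, Real.exp (‖g‖ + ‖c‖) ∂ν :=
        integral_mono hi (integrable_const _) fun y =>
          Real.exp_le_exp.2 (add_kernel_mem_Icc c g x y).2
      _ = _ := by simp

theorem partitionFn_pos (ν : Measure Y) [IsProbabilityMeasure ν] (c : (X × Y) →ᵇ ℝ)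
    (g : Y →ᵇ ℝ) (x : X) : 0 < partitionFn ν c g x :=
  (Real.exp_pos _).trans_le (partitionFn_mem_Icc ν c g x).1

variable [FirstCountableTopology X]

theorem continuous_partitionFn (ν : Measure Y) [IsProbabilityMeasure ν] (c : (X × Y) →ᵇ ℝ)
    (g : Y →ᵇ ℝ) : Continuous (partitionFn ν c g) := by
  refine continuous_of_dominated (bound := fun _ => Real.exp (‖g‖ + ‖c‖))
    (fun x => (continuous_exp_add_kernel c g x).aestronglyMeasurable)
    (fun x => ae_of_all _ fun y => ?_) (integrable_const _) (ae_of_all _ fun y => by fun_prop)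
  rw [Real.norm_eq_abs, Real.abs_exp, Real.exp_le_exp]
  exact (add_kernel_mem_Icc c g x y).2

/-- The soft `c`-transform `x ↦ -log ∫ exp (g y + c (x, y)) dν(y)`. -/
noncomputable def softTransform (ν : Measure Y) [IsProbabilityMeasure ν] (c : (X × Y) →ᵇ ℝ)
    (g : Y →ᵇ ℝ) : X →ᵇ ℝ :=
  BoundedContinuousFunction.ofNormedAddCommGroup (fun x => -Real.log (partitionFn ν c g x))
    ((continuous_partitionFn ν c g).log fun x => (partitionFn_pos ν c g x).ne').neg
    (‖g‖ + ‖c‖) fun x => by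
      have h := partitionFn_mem_Icc ν c g x
      have hp := partitionFn_pos ν c g x
      rw [norm_neg, Real.norm_eq_abs, abs_le, Real.le_log_iff_exp_le hp, Real.log_le_iff_le_exp hp]
      exact h

theorem softTransform_apply (ν : Measure Y) [IsProbabilityMeasure ν] (c : (X × Y) →ᵇ ℝ)
    (g : Y →ᵇ ℝ) (x : X) : softTransform ν c g x = -Real.log (partitionFn ν c g x) := rfl

theorem integral_exp_softTransform (ν : Measure Y) [IsProbabilityMeasure ν] (c : (X × Y) →ᵇ ℝ)
    (g : Y →ᵇ ℝ) (x : X) :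
    ∫ y, Real.exp (softTransform ν c g x + g y + c (x, y)) ∂ν = 1 := by
  have hp := partitionFn_pos ν c g x
  simp_rw [add_assoc, Real.exp_add (softTransform ν c g x)]
  rw [integral_const_mul, softTransform_apply, Real.exp_neg, Real.exp_log hp]
  exact inv_mul_cancel₀ hp.ne'

/-- The ratio of the two partition functions at `x` is the mean of `exp (g' - g)` under the Gibbs
law at `x`. Gibbs laws at two points have densities comparable up to `exp (4 * ‖c‖)`, so the excess
of this mean over its floor `exp m` varies by at most that factor: a Doeblin condition. -/
theorem softTransform_oscillation (ν : Measure Y) [IsProbabilityMeasure ν] (c : (X × Y) →ᵇ ℝ)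
    (g g' : Y →ᵇ ℝ) {D : ℝ} (hD : ∀ y y', (g' - g) y - (g' - g) y' ≤ D) (x x' : X) :
    (softTransform ν c g' - softTransform ν c g) x
      - (softTransform ν c g' - softTransform ν c g) x' ≤ (1 - Real.exp (-(4 * ‖c‖))) * D := by
  have : Nonempty Y := nonempty_of_isProbabilityMeasure ν
  set h := g' - g with hh
  obtain ⟨m, hm⟩ : ∃ m, ∀ y, m ≤ h y ∧ h y ≤ m + D := by
    have hb : BddBelow (Set.range h) := ⟨-‖h‖, by
      rintro _ ⟨y, rfl⟩; exact (abs_le.1 (h.norm_coe_le_norm y)).1⟩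
    refine ⟨⨅ y, h y, fun y => ⟨ciInf_le hb y, ?_⟩⟩
    rw [← sub_le_iff_le_add]
    exact le_ciInf fun y' => by linarith [hD y y']
  set θ := Real.exp (-(4 * ‖c‖)) with hθ
  have hi := integrable_exp_add_kernel ν c
  have hpos := partitionFn_pos ν c
  have hexp : ∀ x y, Real.exp (g' y + c (x, y)) = Real.exp (h y) * Real.exp (g y + c (x, y)) := by
    intro x y
    rw [← Real.exp_add]; congr 1; simp [hh]; ring
  have hlow : ∀ x, Real.exp m * partitionFn ν c g x ≤ partitionFn ν c g' x := by
    intro x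
    rw [partitionFn, ← integral_const_mul]
    refine integral_mono ((hi g x).const_mul _) (hi g' x) fun y => ?_
    simp only [hexp]
    gcongr
    exact (hm y).1
  have hup : ∀ x, partitionFn ν c g' x ≤ Real.exp (m + D) * partitionFn ν c g x := by
    intro x
    rw [partitionFn, partitionFn, ← integral_const_mul]
    refine integral_mono (hi g' x) ((hi g x).const_mul _) fun y => ?_
    simp only [hexp]
    gcongr
    exact (hm y).2
  have hk : ∀ x x' y, Real.exp (g y + c (x, y))
      ≤ Real.exp (2 * ‖c‖) * Real.exp (g y + c (x', y)) := by
    intro x x' y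
    rw [← Real.exp_add, Real.exp_le_exp]
    have h1 := abs_le.1 (c.norm_coe_le_norm (x, y))
    have h2 := abs_le.1 (c.norm_coe_le_norm (x', y))
    linarith [h1.2, h2.1]
  have hZ : ∀ x x', partitionFn ν c g x ≤ Real.exp (2 * ‖c‖) * partitionFn ν c g x' := by
    intro x x'
    rw [partitionFn, partitionFn, ← integral_const_mul]
    exact integral_mono (hi g x) ((hi g x').const_mul _) fun y => hk x x' y
  have hW : ∀ x x', partitionFn ν c g' x - Real.exp m * partitionFn ν c g x
      ≤ Real.exp (2 * ‖c‖) *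
        (partitionFn ν c g' x' - Real.exp m * partitionFn ν c g x') := by
    intro x x'
    simp only [partitionFn]
    rw [← integral_const_mul, ← integral_const_mul, ← integral_sub (hi g' x) ((hi g x).const_mul _),
      ← integral_sub (hi g' x') ((hi g x').const_mul _), ← integral_const_mul]
    refine integral_mono ((hi g' x).sub ((hi g x).const_mul _))
      (((hi g' x').sub ((hi g x').const_mul _)).const_mul _) fun y => ?_
    simp only [hexp]
    have hw : 0 ≤ Real.exp (h y) - Real.exp m := sub_nonneg.2 (Real.exp_le_exp.2 (hm y).1)
    nlinarith [mul_le_mul_of_nonneg_left (hk x x' y) hw]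
  have hθ1 : θ ≤ 1 := by
    rw [hθ]; exact Real.exp_le_one_iff.2 (by linarith [norm_nonneg c])
  have hp := hpos g x
  have hp' := hpos g x'
  have key := log_sub_log_le_of_doeblin (θ := θ) (D := D) (m := m)
    (r := partitionFn ν c g' x / partitionFn ν c g x)
    (r' := partitionFn ν c g' x' / partitionFn ν c g x') (Real.exp_pos _).le hθ1
    ((le_div_iff₀ hp').2 (hlow x')) ((div_le_iff₀ hp').2 (hup x')) (by
      have e1 : θ * Real.exp (2 * ‖c‖) * Real.exp (2 * ‖c‖) = 1 := by
        rw [hθ, ← Real.exp_add, ← Real.exp_add, ← Real.exp_zero]; congr 1; ring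
      have h1 := hW x' x
      have h2 := hZ x x'
      have h0 := sub_nonneg.2 (hlow x)
      have hE := Real.exp_pos (2 * ‖c‖)
      have hθ0 : 0 < θ := Real.exp_pos _
      set A := partitionFn ν c g x
      set A' := partitionFn ν c g x'
      set W := partitionFn ν c g' x
      set W' := partitionFn ν c g' x'
      set E := Real.exp (2 * ‖c‖)
      -- One factor `E` compares the kernels in the numerators, the other the normalizers; `θ`
      -- cancels both.
      have h3 : θ * ((W' - Real.exp m * A') / A') ≤ (W - Real.exp m * A) / A := by
        rw [← mul_div_assoc, div_le_div_iff₀ hp' hp]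
        calc θ * (W' - Real.exp m * A') * A
            ≤ θ * (E * (W - Real.exp m * A)) * (E * A') := by gcongr
          _ = (θ * E * E) * ((W - Real.exp m * A) * A') := by ring
          _ = _ := by rw [e1, one_mul]
      have e2 : (W' - Real.exp m * A') / A' = W' / A' - Real.exp m := by field_simp
      have e3 : (W - Real.exp m * A) / A = W / A - Real.exp m := by field_simp
      rw [e2, e3] at h3
      linarith)
  rw [Real.log_div (hpos g' x').ne' hp'.ne', Real.log_div (hpos g' x).ne' hp.ne'] at key
  simp only [BoundedContinuousFunction.coe_sub, Pi.sub_apply, softTransform_apply]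
  linarith

variable [FirstCountableTopology Y] [MeasurableSpace X] [OpensMeasurableSpace X]

/-- One round of Sinkhorn's iteration, normalized to vanish at `y₀`. -/
noncomputable def sinkhornStep (μ : Measure X) (ν : Measure Y) [IsProbabilityMeasure μ]
    [IsProbabilityMeasure ν] (c : (X × Y) →ᵇ ℝ) (y₀ : Y) (g : Y →ᵇ ℝ) : Y →ᵇ ℝ :=
  softTransform μ (swapKernel c) (softTransform ν c g)
    - BoundedContinuousFunction.const Y
      (softTransform μ (swapKernel c) (softTransform ν c g) y₀)

theorem sinkhornStep_oscillation (μ : Measure X) (ν : Measure Y) [IsProbabilityMeasure μ]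
    [IsProbabilityMeasure ν] (c : (X × Y) →ᵇ ℝ) (y₀ : Y) (g g' : Y →ᵇ ℝ) {D : ℝ}
    (hD : ∀ y y', (g' - g) y - (g' - g) y' ≤ D) (y y' : Y) :
    (sinkhornStep μ ν c y₀ g' - sinkhornStep μ ν c y₀ g) y
      - (sinkhornStep μ ν c y₀ g' - sinkhornStep μ ν c y₀ g) y'
      ≤ (1 - Real.exp (-(4 * ‖c‖))) * D := by
  have h := softTransform_oscillation μ (swapKernel c) _ _
    (softTransform_oscillation ν c g g' hD) y y'
  have hc : 0 ≤ 1 - Real.exp (-(4 * ‖c‖)) :=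
    sub_nonneg.2 (Real.exp_le_one_iff.2 (by linarith [norm_nonneg c]))
  have hD0 : 0 ≤ D := by simpa using hD y₀ y₀
  -- The contraction from one half-step suffices; the other is only used as nonexpansive.
  have h2 : (1 - Real.exp (-(4 * ‖swapKernel c‖))) * ((1 - Real.exp (-(4 * ‖c‖))) * D)
      ≤ (1 - Real.exp (-(4 * ‖c‖))) * D :=
    mul_le_of_le_one_left (mul_nonneg hc hD0) (by linarith [Real.exp_pos (-(4 * ‖swapKernel c‖))])
  simp only [BoundedContinuousFunction.coe_sub, Pi.sub_apply, sinkhornStep,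
    BoundedContinuousFunction.const_apply] at h ⊢
  linarith

theorem sinkhornStep_iterate_oscillation (μ : Measure X) (ν : Measure Y) [IsProbabilityMeasure μ]
    [IsProbabilityMeasure ν] (c : (X × Y) →ᵇ ℝ) (y₀ : Y) (g g' : Y →ᵇ ℝ) (n : ℕ) (y y' : Y) :
    ((sinkhornStep μ ν c y₀)^[n] g' - (sinkhornStep μ ν c y₀)^[n] g) y
      - ((sinkhornStep μ ν c y₀)^[n] g' - (sinkhornStep μ ν c y₀)^[n] g) y'
      ≤ (1 - Real.exp (-(4 * ‖c‖))) ^ n * (2 * ‖g' - g‖) := by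
  induction n generalizing y y' with
  | zero =>
    have h1 := abs_le.1 ((g' - g).norm_coe_le_norm y)
    have h2 := abs_le.1 ((g' - g).norm_coe_le_norm y')
    simp only [Function.iterate_zero, id, pow_zero, one_mul]
    linarith [h1.2, h2.1]
  | succ n ih =>
    rw [Function.iterate_succ_apply', Function.iterate_succ_apply', pow_succ', mul_assoc]
    exact sinkhornStep_oscillation μ ν c y₀ _ _ ih y y'

theorem exists_sinkhornStep_fixedPoint (μ : Measure X) (ν : Measure Y) [IsProbabilityMeasure μ]
    [IsProbabilityMeasure ν] (c : (X × Y) →ᵇ ℝ) (y₀ : Y) :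
    ∃ g, sinkhornStep μ ν c y₀ g = g := by
  set T := sinkhornStep μ ν c y₀ with hT
  set l := 1 - Real.exp (-(4 * ‖c‖)) with hl
  have hl0 : 0 ≤ l := sub_nonneg.2 (Real.exp_le_one_iff.2 (by linarith [norm_nonneg c]))
  have hl1 : l < 1 := by linarith [Real.exp_pos (-(4 * ‖c‖))]
  -- The oscillation of `g' - g` is at most `2 * ‖g' - g‖`, so `1 / 4` yields Lipschitz constant `1
  -- / 2`.
  obtain ⟨n, hn⟩ := exists_pow_lt_of_lt_one (show (0 : ℝ) < 1 / 4 by norm_num) hl1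
  -- Vanishing at `y₀` lets oscillation control the sup norm; the exponent `n + 1` ensures that at
  -- least one normalized step was made.
  have hvan : ∀ g, (T^[n + 1] g) y₀ = 0 := by
    intro g
    rw [Function.iterate_succ_apply']
    simp [hT, sinkhornStep]
  have hlip : LipschitzWith (1 / 2) T^[n + 1] := by
    refine LipschitzWith.of_dist_le_mul fun g' g => ?_
    rw [dist_eq_norm, dist_eq_norm]
    refine (BoundedContinuousFunction.norm_le (by positivity)).2 fun y => ?_
    have h1 := sinkhornStep_iterate_oscillation μ ν c y₀ g g' (n + 1) y y₀
    have h2 := sinkhornStep_iterate_oscillation μ ν c y₀ g g' (n + 1) y₀ y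
    rw [← hT, ← hl] at h1 h2
    have h0 : (T^[n + 1] g' - T^[n + 1] g) y₀ = 0 := by
      rw [BoundedContinuousFunction.coe_sub, Pi.sub_apply, hvan, hvan, sub_zero]
    have h3 : l ^ (n + 1) ≤ 1 / 4 := by
      rw [pow_succ]; nlinarith [pow_nonneg hl0 n]
    have h4 := mul_le_mul_of_nonneg_right h3 (show 0 ≤ 2 * ‖g' - g‖ by positivity)
    rw [Real.norm_eq_abs, abs_le]
    push_cast
    constructor <;> linarith
  have hcon : ContractingWith (1 / 2) T^[n + 1] := ⟨by
    rw [← NNReal.coe_lt_coe]; norm_num, hlip⟩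
  -- `T` commutes with its iterate, hence fixes the iterate's unique fixed point.
  exact ⟨_, hcon.isFixedPt_fixedPoint_iterate⟩

/-- Existence of Schrödinger potentials for a bounded continuous kernel. -/
theorem exists_schrodinger_potentials [OpensMeasurableSpace (X × Y)] (μ : Measure X) (ν : Measure Y) [IsProbabilityMeasure μ]
    [IsProbabilityMeasure ν] (c : (X × Y) →ᵇ ℝ) :
    ∃ (f : X →ᵇ ℝ) (g : Y →ᵇ ℝ), (∀ x, ∫ y, Real.exp (f x + g y + c (x, y)) ∂ν = 1) ∧
      ∀ y, ∫ x, Real.exp (f x + g y + c (x, y)) ∂μ = 1 := by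
  obtain ⟨y₀⟩ : Nonempty Y := nonempty_of_isProbabilityMeasure ν
  obtain ⟨g, hg⟩ := exists_sinkhornStep_fixedPoint μ ν c y₀
  set f := softTransform ν c g with hf
  set s := softTransform μ (swapKernel c) f y₀ with hs
  have hx : ∀ x, ∫ y, Real.exp (f x + g y + c (x, y)) ∂ν = 1 := integral_exp_softTransform ν c g
  have hy : ∀ y, ∫ x, Real.exp (f x + g y + c (x, y)) ∂μ = Real.exp (-s) := by
    intro y
    have h1 := integral_exp_softTransform μ (swapKernel c) f y
    have h2 : softTransform μ (swapKernel c) f y = g y + s := by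
      have := DFunLike.congr_fun hg y
      simp only [sinkhornStep, BoundedContinuousFunction.coe_sub, Pi.sub_apply,
        BoundedContinuousFunction.const_apply] at this
      linarith
    rw [h2] at h1
    have h3 : ∀ x, Real.exp (g y + s + f x + swapKernel c (y, x))
        = Real.exp s * Real.exp (f x + g y + c (x, y)) := by
      intro x
      rw [← Real.exp_add, swapKernel_apply]; congr 1; ring
    simp_rw [h3] at h1
    rw [integral_const_mul] at h1
    rw [Real.exp_neg]
    exact eq_inv_of_mul_eq_one_right h1
  have hint : Integrable (Function.uncurry fun x y => Real.exp (f x + g y + c (x, y)))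
      (μ.prod ν) := by
    refine Integrable.of_bound (C := Real.exp (‖f‖ + ‖g‖ + ‖c‖)) (Continuous.aestronglyMeasurable
      (by unfold Function.uncurry; fun_prop)) (ae_of_all _ fun p => ?_)
    rw [Function.uncurry, Real.norm_eq_abs, Real.abs_exp, Real.exp_le_exp]
    have h1 := abs_le.1 (f.norm_coe_le_norm p.1)
    have h2 := abs_le.1 (g.norm_coe_le_norm p.2)
    have h3 := abs_le.1 (c.norm_coe_le_norm (p.1, p.2))
    linarith [h1.2, h2.2, h3.2]
  -- The normalized fixed point solves the second equation only up to the factor `exp (-s)`;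
  -- comparing total masses by Fubini shows that it is one.
  have hswap := integral_integral_swap hint
  simp only [hx, hy, integral_const, probReal_univ, smul_eq_mul, one_mul] at hswap
  refine ⟨f, g, hx, fun y => ?_⟩
  rw [hy y, ← hswap]

end Schrodinger

/-! ### Relative entropy and the Gibbs variational principle. -/

theorem klDiv_tilted_right_ne_top {α : Type*} [MeasurableSpace α] {Q P : Measure α}
    [IsProbabilityMeasure Q] [IsProbabilityMeasure P] {φ : α → ℝ} (hφQ : Integrable φ Q)
    (hφP : Integrable (fun x => Real.exp (φ x)) P) (hQ : klDiv Q P ≠ ⊤) :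
    klDiv Q (P.tilted φ) ≠ ⊤ := by
  obtain ⟨hac, hint⟩ := klDiv_ne_top_iff.1 hQ
  exact klDiv_ne_top (hac.trans (absolutelyContinuous_tilted hφP))
    (integrable_llr_tilted_right hac hφQ hint hφP)

theorem toReal_klDiv_tilted_right {α : Type*} [MeasurableSpace α] {Q P : Measure α}
    [IsProbabilityMeasure Q] [IsProbabilityMeasure P] {φ : α → ℝ} (hφQ : Integrable φ Q)
    (hφP : Integrable (fun x => Real.exp (φ x)) P) (hQ : klDiv Q P ≠ ⊤) :
    (klDiv Q (P.tilted φ)).toReal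
      = (klDiv Q P).toReal - ∫ x, φ x ∂Q + Real.log (∫ x, Real.exp (φ x) ∂P) := by
  obtain ⟨hac, hint⟩ := klDiv_ne_top_iff.1 hQ
  have := isProbabilityMeasure_tilted hφP
  rw [toReal_klDiv_of_measure_eq (hac.trans (absolutelyContinuous_tilted hφP)) (by simp),
    toReal_klDiv_of_measure_eq hac (by simp), integral_llr_tilted_right hac hφQ hφP hint]

theorem klDiv_tilted_left_ne_top {α : Type*} [MeasurableSpace α] {P : Measure α}
    [IsProbabilityMeasure P] {φ : α → ℝ} (hφ : Integrable φ (P.tilted φ))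
    (hφP : Integrable (fun x => Real.exp (φ x)) P) : klDiv (P.tilted φ) P ≠ ⊤ := by
  have := isProbabilityMeasure_tilted hφP
  refine klDiv_ne_top (tilted_absolutelyContinuous P φ) ?_
  have h := (tilted_absolutelyContinuous P φ).ae_le (log_rnDeriv_tilted_left_self hφP)
  exact (integrable_congr h).2 (hφ.sub (integrable_const _))

theorem isProbabilityMeasure_of_mem_couplings {μ ν : Measure ℝ} [IsProbabilityMeasure μ]
    {π : Measure (ℝ × ℝ)} (hπ : π ∈ couplings μ ν) : IsProbabilityMeasure π := by
  refine ⟨?_⟩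
  rw [← Measure.fst_univ, hπ.1, measure_univ]

theorem ae_prod_mem_of_mem_couplings {μ ν : Measure ℝ} {S T : Set ℝ} (hμ : ∀ᵐ x ∂μ, x ∈ S)
    (hν : ∀ᵐ y ∂ν, y ∈ T) {π : Measure (ℝ × ℝ)} (hπ : π ∈ couplings μ ν) :
    ∀ᵐ p ∂π, p ∈ S ×ˢ T := by
  rw [← hπ.1, Measure.fst] at hμ
  rw [← hπ.2, Measure.snd] at hν
  filter_upwards [ae_of_ae_map measurable_fst.aemeasurable hμ,
    ae_of_ae_map measurable_snd.aemeasurable hν] with p h1 h2 using ⟨h1, h2⟩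

theorem integral_fst_of_mem_couplings {μ ν : Measure ℝ} {π : Measure (ℝ × ℝ)}
    (hπ : π ∈ couplings μ ν) {f : ℝ → ℝ} (hf : Continuous f) :
    ∫ p, f p.1 ∂π = ∫ x, f x ∂μ := by
  rw [← hπ.1, Measure.fst, integral_map measurable_fst.aemeasurable hf.aestronglyMeasurable]

theorem integral_snd_of_mem_couplings {μ ν : Measure ℝ} {π : Measure (ℝ × ℝ)}
    (hπ : π ∈ couplings μ ν) {f : ℝ → ℝ} (hf : Continuous f) :
    ∫ p, f p.2 ∂π = ∫ x, f x ∂ν := by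
  rw [← hπ.2, Measure.snd, integral_map measurable_snd.aemeasurable hf.aestronglyMeasurable]

/-- On a bounded coupling, average rank preservation is the covariance. -/
theorem avgRank_eq_covariance {μ ν : Measure ℝ} [IsProbabilityMeasure μ] {M : ℝ}
    (hμ : ∀ᵐ x ∂μ, x ∈ Set.Icc (-M) M) (hν : ∀ᵐ y ∂ν, y ∈ Set.Icc (-M) M)
    {π : Measure (ℝ × ℝ)} (hπ : π ∈ couplings μ ν) :
    avgRank π = ∫ p, p.1 * p.2 ∂π - (∫ x, x ∂μ) * ∫ y, y ∂ν := by
  have := isProbabilityMeasure_of_mem_couplings hπ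
  have hae := ae_prod_mem_of_mem_couplings hμ hν hπ
  have i1 : Integrable (fun p : ℝ × ℝ => p.1) π :=
    Integrable.of_bound continuous_fst.aestronglyMeasurable M
      (hae.mono fun p hp => abs_le.2 hp.1)
  have i2 : Integrable (fun p : ℝ × ℝ => p.2) π :=
    Integrable.of_bound continuous_snd.aestronglyMeasurable M
      (hae.mono fun p hp => abs_le.2 hp.2)
  have i12 : Integrable (fun p : ℝ × ℝ => p.1 * p.2) π := by
    refine Integrable.of_bound (by fun_prop) (M * M) (hae.mono fun p hp => ?_)
    rw [norm_mul]
    have h1 : ‖p.1‖ ≤ M := abs_le.2 hp.1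
    have h2 : ‖p.2‖ ≤ M := abs_le.2 hp.2
    exact mul_le_mul h1 h2 (norm_nonneg _) ((norm_nonneg _).trans h1)
  have e1 := integral_fst_of_mem_couplings hπ continuous_id
  have e2 := integral_snd_of_mem_couplings hπ continuous_id
  simp only [id] at e1 e2
  -- After expansion both the inner and the outer integrand have this form, so one formula serves
  -- twice.
  have hlin : ∀ a b c d : ℝ, ∫ q, (a * (q.1 * q.2) + b * q.1 + c * q.2 + d) ∂π
      = a * (∫ q, q.1 * q.2 ∂π) + b * (∫ x, x ∂μ) + c * (∫ y, y ∂ν) + d := by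
    intro a b c d
    have j1 : Integrable (fun q : ℝ × ℝ => a * (q.1 * q.2)) π := i12.const_mul a
    have j2 : Integrable (fun q : ℝ × ℝ => a * (q.1 * q.2) + b * q.1) π := j1.add (i1.const_mul b)
    have j3 : Integrable (fun q : ℝ × ℝ => a * (q.1 * q.2) + b * q.1 + c * q.2) π :=
      j2.add (i2.const_mul c)
    rw [integral_add j3 (integrable_const d), integral_add j2 (i2.const_mul c),
      integral_add j1 (i1.const_mul b), integral_const_mul, integral_const_mul,
      integral_const_mul, e1, e2]
    simp
  have hin : ∀ p : ℝ × ℝ, ∫ q, (p.1 - q.1) * (p.2 - q.2) ∂π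
      = 1 * (p.1 * p.2) + -(∫ y, y ∂ν) * p.1 + -(∫ x, x ∂μ) * p.2 + ∫ q, q.1 * q.2 ∂π := by
    intro p
    have h : ∀ q : ℝ × ℝ, (p.1 - q.1) * (p.2 - q.2)
        = 1 * (q.1 * q.2) + -p.2 * q.1 + -p.1 * q.2 + p.1 * p.2 := fun q => by ring
    simp_rw [h]
    rw [hlin]
    ring
  rw [avgRank]
  simp_rw [hin]
  rw [hlin]
  ring

/-- If average rank preservation agrees on couplings with `a + ε ∫ φ` and the Gibbs measure of `φ`
is a coupling, then it is the unique maximizer. -/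
theorem isRankMaximizer_tilted_unique {μ ν : Measure ℝ} [IsProbabilityMeasure μ]
    [IsProbabilityMeasure ν] {ρ : ℝ} (hε : 0 < stickinessEps ρ) {φ : ℝ × ℝ → ℝ}
    (hφ : ∀ π ∈ couplings μ ν, Integrable φ π)
    (hexp : Integrable (fun p => Real.exp (φ p)) (μ.prod ν)) {a : ℝ}
    (ha : ∀ π ∈ couplings μ ν, avgRank π = a + stickinessEps ρ * ∫ p, φ p ∂π)
    (hmem : (μ.prod ν).tilted φ ∈ couplings μ ν) :
    IsRankMaximizer μ ν ρ ((μ.prod ν).tilted φ) ∧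
      ∀ π, IsRankMaximizer μ ν ρ π → π = (μ.prod ν).tilted φ := by
  set Q := (μ.prod ν).tilted φ with hQ
  set ε := stickinessEps ρ with hεd
  have : IsProbabilityMeasure Q := isProbabilityMeasure_of_mem_couplings hmem
  set b := a + ε * Real.log (∫ p, Real.exp (φ p) ∂(μ.prod ν)) with hb
  have hfin : ∀ π ∈ couplings μ ν, klDiv π (μ.prod ν) ≠ ⊤ →
      rankObjective μ ν ρ π = ((b - ε * (klDiv π Q).toReal : ℝ) : EReal) := by
    intro π hπ htop
    have := isProbabilityMeasure_of_mem_couplings hπ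
    rw [rankObjective, ← hεd, ← EReal.coe_ennreal_toReal htop, ha π hπ, ← EReal.coe_mul,
      ← EReal.coe_sub, toReal_klDiv_tilted_right (hφ π hπ) hexp htop, hb]
    congr 1
    ring
  have htop : ∀ π ∈ couplings μ ν, klDiv π (μ.prod ν) = ⊤ → rankObjective μ ν ρ π = ⊥ := by
    intro π _ h
    rw [rankObjective, h, EReal.coe_ennreal_top, EReal.coe_mul_top_of_pos hε, sub_eq_add_neg, EReal.neg_top,
      EReal.add_bot]
  have hQval : rankObjective μ ν ρ Q = (b : EReal) := by
    rw [hfin Q hmem (klDiv_tilted_left_ne_top (hφ _ hmem) hexp), klDiv_self]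
    simp
  refine ⟨⟨hmem, fun π hπ => ?_⟩, fun π hπ => ?_⟩
  · rw [Set.mem_ofPred_eq, hQval]
    by_cases h : klDiv π (μ.prod ν) = ⊤
    · rw [htop π hπ h]; exact bot_le
    · rw [hfin π hπ h, EReal.coe_le_coe_iff]
      have := mul_nonneg hε.le (klDiv π Q).toReal_nonneg
      linarith
  · have hle : rankObjective μ ν ρ Q ≤ rankObjective μ ν ρ π := hπ.2 hmem
    have := isProbabilityMeasure_of_mem_couplings hπ.1
    -- The Gibbs measure has finite value `b`, so a maximizer cannot have infinite divergence.
    have h : klDiv π (μ.prod ν) ≠ ⊤ := by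
      intro h
      rw [htop π hπ.1 h, hQval] at hle
      exact absurd hle (not_le.2 (EReal.bot_lt_coe b))
    rw [hQval, hfin π hπ.1 h, EReal.coe_le_coe_iff] at hle
    have h0 : (klDiv π Q).toReal = 0 := by
      have := (klDiv π Q).toReal_nonneg
      nlinarith
    refine klDiv_eq_zero_iff.1 ((ENNReal.toReal_eq_zero_iff _).1 h0 |>.resolve_right ?_)
    exact klDiv_tilted_right_ne_top (hφ π hπ.1) hexp h

/-! ### Conditional laws with exponential densities. -/

section DensityKernel

variable {X Y : Type*} [MeasurableSpace X] [MeasurableSpace Y]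

/-- The kernel `x ↦ exp (φ (x, y)) dν(y)`. -/
noncomputable def expDensityKernel (ν : Measure Y) [SFinite ν] (φ : X × Y → ℝ) : Kernel X Y :=
  Kernel.withDensity (Kernel.const X ν) fun x y => ENNReal.ofReal (Real.exp (φ (x, y)))

theorem measurable_ofReal_exp {φ : X × Y → ℝ} (hφ : Measurable φ) :
    Measurable (Function.uncurry fun x y => ENNReal.ofReal (Real.exp (φ (x, y)))) := by
  unfold Function.uncurry
  fun_prop

theorem expDensityKernel_apply (ν : Measure Y) [SFinite ν] {φ : X × Y → ℝ} (hφ : Measurable φ)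
    (x : X) : expDensityKernel ν φ x
      = ν.withDensity fun y => ENNReal.ofReal (Real.exp (φ (x, y))) := by
  rw [expDensityKernel, Kernel.withDensity_apply _ (measurable_ofReal_exp hφ), Kernel.const_apply]

theorem lintegral_ofReal_exp_eq_one {ν : Measure Y} {ψ : Y → ℝ}
    (h : ∫ y, Real.exp (ψ y) ∂ν = 1) : ∫⁻ y, ENNReal.ofReal (Real.exp (ψ y)) ∂ν = 1 := by
  have hi : Integrable (fun y => Real.exp (ψ y)) ν := by
    by_contra hi
    rw [integral_undef hi] at h
    exact zero_ne_one h
  rw [← ofReal_integral_eq_lintegral_ofReal hi (ae_of_all _ fun y => (Real.exp_pos _).le), h,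
    ENNReal.ofReal_one]

theorem isMarkovKernel_expDensityKernel {ν : Measure Y} [SFinite ν] {φ : X × Y → ℝ}
    (hφ : Measurable φ) (h : ∀ x, ∫ y, Real.exp (φ (x, y)) ∂ν = 1) :
    IsMarkovKernel (expDensityKernel ν φ) := by
  refine ⟨fun x => ⟨?_⟩⟩
  rw [expDensityKernel_apply ν hφ, withDensity_apply _ MeasurableSet.univ, Measure.restrict_univ]
  exact lintegral_ofReal_exp_eq_one (h x)

theorem integral_prod_exp_eq_one {μ : Measure X} {ν : Measure Y} [IsProbabilityMeasure μ]
    [SFinite ν] {φ : X × Y → ℝ} (hφP : Integrable (fun p => Real.exp (φ p)) (μ.prod ν))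
    (h : ∀ x, ∫ y, Real.exp (φ (x, y)) ∂ν = 1) : ∫ p, Real.exp (φ p) ∂(μ.prod ν) = 1 := by
  rw [integral_prod _ hφP]
  simp [h]

theorem tilted_eq_withDensity_of_integral_eq_one {P : Measure X} {φ : X → ℝ}
    (h : ∫ p, Real.exp (φ p) ∂P = 1) :
    P.tilted φ = P.withDensity fun p => ENNReal.ofReal (Real.exp (φ p)) := by
  simp [Measure.tilted, h]

theorem compProd_expDensityKernel {μ : Measure X} {ν : Measure Y} [SFinite μ] [SFinite ν]
    {φ : X × Y → ℝ} (hφ : Measurable φ) [IsMarkovKernel (expDensityKernel ν φ)] :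
    μ ⊗ₘ expDensityKernel ν φ
      = (μ.prod ν).withDensity fun p => ENNReal.ofReal (Real.exp (φ p)) := by
  have hm : Measurable fun p => ENNReal.ofReal (Real.exp (φ p)) := by fun_prop
  ext s hs
  rw [Measure.compProd_apply hs, withDensity_apply _ hs, ← lintegral_indicator hs,
    lintegral_prod _ (hm.indicator hs).aemeasurable]
  refine lintegral_congr fun x => ?_
  rw [expDensityKernel_apply ν hφ, withDensity_apply _ (measurable_prodMk_left hs),
    ← lintegral_indicator (measurable_prodMk_left hs)]
  rfl

theorem snd_withDensity_prod_of_integral_eq_one {μ : Measure X} {ν : Measure Y} [SFinite μ]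
    [SFinite ν] {φ : X × Y → ℝ} (hφ : Measurable φ)
    (h : ∀ y, ∫ x, Real.exp (φ (x, y)) ∂μ = 1) :
    ((μ.prod ν).withDensity fun p => ENNReal.ofReal (Real.exp (φ p))).snd = ν := by
  have hm : Measurable fun p => ENNReal.ofReal (Real.exp (φ p)) := by fun_prop
  ext s hs
  rw [Measure.snd_apply hs, withDensity_apply _ (measurable_snd hs), ← Set.univ_prod,
    ← Measure.prod_restrict, Measure.restrict_univ, lintegral_prod_symm _ hm.aemeasurable]
  simp [fun y => lintegral_ofReal_exp_eq_one (h y)]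

theorem continuous_integral_expDensityKernel [TopologicalSpace X] [TopologicalSpace Y]
    [FirstCountableTopology X] [OpensMeasurableSpace Y] {ν : Measure Y}
    [IsFiniteMeasure ν] (φ : (X × Y) →ᵇ ℝ) (hφ : Measurable φ) (h : Y →ᵇ ℝ) :
    Continuous fun x => ∫ y, h y ∂(expDensityKernel ν φ x) := by
  have hexp : ∀ x, Measurable fun y => Real.exp (φ (x, y)) := fun x => by fun_prop
  have heq : ∀ x, ∫ y, h y ∂(expDensityKernel ν φ x) = ∫ y, Real.exp (φ (x, y)) * h y ∂ν := by
    intro x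
    rw [expDensityKernel_apply ν hφ, integral_withDensity_eq_integral_toReal_smul
      (hexp x).ennreal_ofReal (ae_of_all _ fun y => ENNReal.ofReal_lt_top)]
    simp [ENNReal.toReal_ofReal, Real.exp_nonneg]
  simp_rw [heq]
  refine continuous_of_dominated (bound := fun _ => Real.exp ‖φ‖ * ‖h‖)
    (fun x => Continuous.aestronglyMeasurable (by fun_prop)) (fun x => ae_of_all _ fun y => ?_)
    (integrable_const _) (ae_of_all _ fun y => by fun_prop)
  rw [norm_mul, Real.norm_eq_abs, Real.abs_exp]
  gcongr
  · exact (abs_le.1 (φ.norm_coe_le_norm (x, y))).2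
  · exact h.norm_coe_le_norm y

end DensityKernel

/-! ### Positive densities and uniqueness of the continuous version. -/

/-- A convex set has null frontier, so a non-null one has interior points, and these are dense in
it. This lets almost everywhere equality of continuous functions extend to endpoints in `S`. -/
theorem Set.OrdConnected.subset_closure_interior {S : Set ℝ} (hS : S.OrdConnected)
    (h0 : volume S ≠ 0) : S ⊆ closure (interior S) := by
  have hconv : Convex ℝ S := hS.convex
  have hne : (interior S).Nonempty := by
    by_contra hne
    rw [Set.not_nonempty_iff_eq_empty] at hne
    refine h0 (measure_mono_null ?_ (hconv.addHaar_frontier volume))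
    rw [frontier, hne, Set.sdiff_empty]
    exact subset_closure
  rw [hconv.closure_interior_eq_closure_of_nonempty_interior hne]
  exact subset_closure

theorem HasPositiveDensityOn.absolutelyContinuous {S : Set ℝ} {μ : Measure ℝ}
    (h : HasPositiveDensityOn S μ) : μ ≪ volume.restrict S := by
  obtain ⟨f, -, -, rfl⟩ := h
  exact withDensity_absolutelyContinuous _ _

theorem HasPositiveDensityOn.restrict_absolutelyContinuous {S : Set ℝ} (hS : MeasurableSet S)
    {μ : Measure ℝ} (h : HasPositiveDensityOn S μ) : volume.restrict S ≪ μ := by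
  obtain ⟨f, hf, hpos, rfl⟩ := h
  refine withDensity_absolutelyContinuous' hf.ennreal_ofReal.aemeasurable ?_
  filter_upwards [ae_restrict_mem hS] with y hy
  simpa using hpos y hy

theorem HasPositiveDensityOn.ae_mem {S : Set ℝ} (hS : MeasurableSet S) {μ : Measure ℝ}
    (h : HasPositiveDensityOn S μ) : ∀ᵐ x ∂μ, x ∈ S :=
  h.absolutelyContinuous.ae_le (ae_restrict_mem hS)

theorem HasPositiveDensityOn.measure_singleton {S : Set ℝ} {μ : Measure ℝ}
    (h : HasPositiveDensityOn S μ) (y : ℝ) : μ {y} = 0 :=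
  h.absolutelyContinuous (Measure.absolutelyContinuous_of_le Measure.restrict_le_self
    Real.volume_singleton)

/-- A weakly continuous version of a conditional law is determined at every point of `S`. -/
theorem IsContinuousCondLaw.apply_eq {S : Set ℝ} (hS : S.OrdConnected) {μ : Measure ℝ}
    [IsProbabilityMeasure μ] (hμ : HasPositiveDensityOn S μ) {π : Measure (ℝ × ℝ)}
    (hπ : π.fst = μ) {κ κ' : Kernel ℝ ℝ} (h : IsContinuousCondLaw S π κ)
    (h' : IsContinuousCondLaw S π κ') {y : ℝ} (hy : y ∈ S) : κ' y = κ y := by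
  have := h.isMarkov
  have := h'.isMarkov
  have hae : κ' =ᵐ[μ] κ := Kernel.ae_eq_of_compProd_eq (by
    rw [← hπ, h'.isCond.disintegrate, h.isCond.disintegrate])
  have hvol : volume S ≠ 0 := by
    intro h0
    have := hμ.absolutelyContinuous (s := Set.univ) (by simpa using h0)
    simp at this
  refine ext_of_forall_integral_eq_of_IsFiniteMeasure fun g => ?_
  refine Measure.eqOn_of_ae_eq (μ := volume) ?_ (h'.continuousOn g) (h.continuousOn g)
    (hS.subset_closure_interior hvol) hy
  filter_upwards [(hμ.restrict_absolutelyContinuous hS.measurableSet).ae_le hae] with x hx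
  rw [hx]

/-! ### Quantiles. -/

/-- Right continuity of the distribution function makes the infimum attained. -/
theorem le_cdf_quantileFn (μ : Measure ℝ) {u : ℝ} (hu : u ∈ Set.Ioo (0 : ℝ) 1) :
    u ≤ cdf μ (quantileFn μ u) ∧ ∀ y < quantileFn μ u, cdf μ y < u := by
  set A := {y : ℝ | u ≤ cdf μ y} with hA
  have hne : A.Nonempty :=
    (((tendsto_cdf_atTop μ).eventually (lt_mem_nhds hu.2)).exists).imp fun y hy => hy.le
  obtain ⟨b, hb⟩ := ((tendsto_cdf_atBot μ).eventually (gt_mem_nhds hu.1)).exists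
  have hbdd : BddBelow A := ⟨b, fun y hy => by
    by_contra hlt
    exact absurd ((monotone_cdf μ) (not_le.1 hlt).le) (not_le.2 (hb.trans_le hy))⟩
  refine ⟨?_, fun y hy => not_le.1 fun h => absurd (csInf_le hbdd h) (not_le.2 hy)⟩
  have hc : Filter.Tendsto (cdf μ) (nhdsWithin (sInf A) (Set.Ioi (sInf A)))
      (nhds (cdf μ (sInf A))) :=
    ((cdf μ).right_continuous (sInf A)).mono_left (nhdsWithin_mono _ Set.Ioi_subset_Ici_self)
  refine ge_of_tendsto hc ?_
  filter_upwards [self_mem_nhdsWithin] with y hy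
  obtain ⟨a, ha, hay⟩ := exists_lt_of_csInf_lt hne hy
  exact le_trans ha (monotone_cdf μ hay.le)

/-- Both closed half-lines at the quantile have positive mass, as `F q ≥ u > 0` and `F (q-) ≤ u <
1`. Each therefore meets `S`, and order-connectedness places `q` between two points of `S`. -/
theorem quantileFn_mem {S : Set ℝ} (hS : S.OrdConnected) {μ : Measure ℝ} [IsProbabilityMeasure μ]
    (hμ : ∀ᵐ x ∂μ, x ∈ S) {u : ℝ} (hu : u ∈ Set.Ioo (0 : ℝ) 1) : quantileFn μ u ∈ S := by
  obtain ⟨h1, h2⟩ := le_cdf_quantileFn μ hu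
  set q := quantileFn μ u
  obtain ⟨a, ha, haS⟩ : ∃ a ≤ q, a ∈ S := by
    by_contra! hno
    have h0 : μ (Set.Iic q) = 0 := measure_mono_null (fun x hx => hno x hx) hμ
    rw [← ofReal_cdf, ENNReal.ofReal_eq_zero] at h0
    exact absurd h0 (not_le.2 (hu.1.trans_le h1))
  obtain ⟨b, hb, hbS⟩ : ∃ b ≥ q, b ∈ S := by
    by_contra! hno
    have h0 : μ (Set.Ici q) = 0 := measure_mono_null (fun x hx => hno x hx) hμ
    have hlim : Function.leftLim (cdf μ) q ≤ u := by
      refine le_of_tendsto ((monotone_cdf μ).tendsto_leftLim q) ?_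
      filter_upwards [self_mem_nhdsWithin] with y hy using (h2 y hy).le
    rw [← measure_cdf μ, StieltjesFunction.measure_Ici _ (tendsto_cdf_atTop μ),
      ENNReal.ofReal_eq_zero] at h0
    linarith [hu.2]
  exact hS.out haS hbS ⟨ha, hb⟩

/-! ### The Gibbs maximizer and rank violations. -/

/-- The kernel `(x, y) ↦ x y / ε`, with both coordinates clamped to `[-M, M]`. -/
noncomputable def clampedProduct (M ε : ℝ) : (ℝ × ℝ) →ᵇ ℝ :=
  BoundedContinuousFunction.ofNormedAddCommGroup
    (fun p => max (-M) (min M p.1) * max (-M) (min M p.2) / ε) (by fun_prop) (|M| * |M| / |ε|)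
    fun p => by
      have h : ∀ t : ℝ, |max (-M) (min M t)| ≤ |M| := fun t => abs_le.2
        ⟨(neg_le_neg (le_abs_self M)).trans (le_max_left _ _),
          max_le (neg_le_abs M) ((min_le_left _ _).trans (le_abs_self M))⟩
      rw [norm_div, norm_mul]
      exact div_le_div_of_nonneg_right
        (mul_le_mul (h p.1) (h p.2) (abs_nonneg _) (abs_nonneg _)) (abs_nonneg _)

theorem clampedProduct_apply {M ε : ℝ} {p : ℝ × ℝ}
    (hp : p ∈ Set.Icc (-M) M ×ˢ Set.Icc (-M) M) : clampedProduct M ε p = p.1 * p.2 / ε := by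
  change max (-M) (min M p.1) * max (-M) (min M p.2) / ε = _
  rw [min_eq_right hp.1.2, min_eq_right hp.2.2, max_eq_right hp.1.1, max_eq_right hp.2.1]

/-- The maximizer is a Gibbs measure with bounded continuous log-density, whose conditional
densities are normalized at every point. -/
theorem exists_gibbs_maximizer {μ ν : Measure ℝ} [IsProbabilityMeasure μ] [IsProbabilityMeasure ν]
    {M : ℝ} (hμ : ∀ᵐ x ∂μ, x ∈ Set.Icc (-M) M) (hν : ∀ᵐ y ∂ν, y ∈ Set.Icc (-M) M) {ρ : ℝ}
    (hε : 0 < stickinessEps ρ) :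
    ∃ φ : (ℝ × ℝ) →ᵇ ℝ, IsMarkovKernel (expDensityKernel ν φ) ∧
      IsRankMaximizer μ ν ρ (μ ⊗ₘ expDensityKernel ν φ) ∧
      ∀ π, IsRankMaximizer μ ν ρ π → π = μ ⊗ₘ expDensityKernel ν φ := by
  set ε := stickinessEps ρ with hεd
  -- Clamping makes the kernel bounded on the whole plane and changes nothing on the box that
  -- carries every coupling.
  set c := clampedProduct M ε with hc
  obtain ⟨f, g, hx, hy⟩ := exists_schrodinger_potentials μ ν c
  set φ : (ℝ × ℝ) →ᵇ ℝ := f.compContinuous ⟨Prod.fst, continuous_fst⟩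
    + g.compContinuous ⟨Prod.snd, continuous_snd⟩ + c with hφ
  have hφm : Measurable φ := φ.continuous.measurable
  have hx' : ∀ x, ∫ y, Real.exp (φ (x, y)) ∂ν = 1 := hx
  have hy' : ∀ y, ∫ x, Real.exp (φ (x, y)) ∂μ = 1 := hy
  have hmk := isMarkovKernel_expDensityKernel hφm hx'
  have hexp : Integrable (fun p => Real.exp (φ p)) (μ.prod ν) := by
    refine Integrable.of_bound (C := Real.exp ‖φ‖) (by fun_prop) (ae_of_all _ fun p => ?_)
    rw [Real.norm_eq_abs, Real.abs_exp, Real.exp_le_exp]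
    exact (abs_le.1 (φ.norm_coe_le_norm p)).2
  have htilt := tilted_eq_withDensity_of_integral_eq_one (integral_prod_exp_eq_one hexp hx')
  have hcomp := compProd_expDensityKernel (μ := μ) (ν := ν) hφm
  have hmem : (μ.prod ν).tilted φ ∈ couplings μ ν := by
    constructor
    · rw [htilt, ← hcomp, Measure.fst_compProd]
    · rw [htilt]
      exact snd_withDensity_prod_of_integral_eq_one hφm hy'
  refine ⟨φ, hmk, ?_⟩
  rw [hcomp, ← htilt]
  have hint : ∀ π ∈ couplings μ ν, ∀ ψ : (ℝ × ℝ) →ᵇ ℝ, Integrable ψ π := by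
    intro π hπ ψ
    have := isProbabilityMeasure_of_mem_couplings hπ
    exact ψ.integrable π
  refine isRankMaximizer_tilted_unique hε (fun π hπ => hint π hπ φ) hexp
    -- The potentials integrate to the same value under every coupling, so they enter only the
    -- constant.
    (a := -((∫ x, x ∂μ) * ∫ y, y ∂ν) - ε * (∫ x, f x ∂μ + ∫ y, g y ∂ν)) (fun π hπ => ?_) hmem
  have hsum : ∫ p, φ p ∂π = ∫ x, f x ∂μ + ∫ y, g y ∂ν + ∫ p, c p ∂π := by
    have hf := hint π hπ (f.compContinuous ⟨Prod.fst, continuous_fst⟩)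
    have hg := hint π hπ (g.compContinuous ⟨Prod.snd, continuous_snd⟩)
    rw [← integral_fst_of_mem_couplings hπ f.continuous,
      ← integral_snd_of_mem_couplings hπ g.continuous]
    exact (integral_add (hf.add hg) (hint π hπ c)).trans
      (congrArg (· + ∫ p, c p ∂π) (integral_add hf hg))
  have hcint : ∫ p, c p ∂π = (∫ p, p.1 * p.2 ∂π) / ε := by
    rw [← integral_div]
    refine integral_congr_ae ?_
    filter_upwards [ae_prod_mem_of_mem_couplings hμ hν hπ] with p hp
    exact clampedProduct_apply hp
  rw [avgRank_eq_covariance hμ hν hπ, hsum, hcint]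
  field_simp
  ring

theorem proposition2 (S : Set ℝ) (hS : S.OrdConnected) (hSb : Bornology.IsBounded S)
    (μ ν : Measure ℝ) [IsProbabilityMeasure μ] [IsProbabilityMeasure ν]
    (hμ : HasPositiveDensityOn S μ) (hν : HasPositiveDensityOn S ν)
    (ρ : ℝ) (hρ : ρ ∈ Set.Ioo (0 : ℝ) 1) :
    ∃ π : Measure (ℝ × ℝ),
      (IsRankMaximizer μ ν ρ π ∧ ∀ π' : Measure (ℝ × ℝ), IsRankMaximizer μ ν ρ π' → π' = π) ∧
      (∃ κ : Kernel ℝ ℝ,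
        (IsContinuousCondLaw S π κ ∧
          ∀ κ' : Kernel ℝ ℝ, IsContinuousCondLaw S π κ' → ∀ y ∈ S, κ' y = κ y) ∧
        ∀ u ∈ Set.Ioo (0 : ℝ) 1,
          quantileFn μ u ∈ S ∧ 0 < κ (quantileFn μ u) {y₁ : ℝ | y₁ ≠ quantileFn ν u}) ∧
      0 < π {p : ℝ × ℝ | p.2 ≠ quantileFn ν (cdf μ p.1)} := by
  have hμS := hμ.ae_mem hS.measurableSet
  have hνS := hν.ae_mem hS.measurableSet
  obtain ⟨M, hM⟩ := hSb.exists_norm_le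
  have hSM : ∀ x ∈ S, x ∈ Set.Icc (-M) M := fun x hx => abs_le.1 (hM x hx)
  have hε : 0 < stickinessEps ρ := div_pos (sub_pos.2 hρ.2) hρ.1
  obtain ⟨φ, hmk, hmax, huniq⟩ := exists_gibbs_maximizer (hμS.mono hSM) (hνS.mono hSM) hε
  have hφm : Measurable φ := φ.continuous.measurable
  set κ := expDensityKernel ν φ with hκ
  have hκlaw : IsContinuousCondLaw S (μ ⊗ₘ κ) κ :=
    ⟨hmk, ⟨by rw [Measure.fst_compProd]⟩,
      fun h => (continuous_integral_expDensityKernel φ hφm h).continuousOn⟩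
  -- Absolute continuity with respect to the atomless `ν` gives this for every `x`, not merely
  -- almost every one.
  have hatom : ∀ x y, κ x {y₁ | y₁ ≠ y} = 1 := by
    intro x y
    have h0 : κ x {y} = 0 := by
      rw [hκ, expDensityKernel_apply ν hφm]
      exact withDensity_absolutelyContinuous _ _ (hν.measure_singleton y)
    exact (prob_compl_eq_one_iff (measurableSet_singleton y)).2 h0
  refine ⟨μ ⊗ₘ κ, ⟨hmax, huniq⟩, ⟨κ, ⟨hκlaw, fun κ' hκ' y hy =>
    hκlaw.apply_eq hS hμ (Measure.fst_compProd μ κ) hκ' hy⟩, fun u hu =>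
    ⟨quantileFn_mem hS hμS hu, ?_⟩⟩, ?_⟩
  · rw [hatom]; exact one_pos
  · refine pos_iff_ne_zero.2 fun h0 => ?_
    have hae : ∀ᵐ p ∂(μ ⊗ₘ κ), p.2 = quantileFn ν (cdf μ p.1) := h0
    obtain ⟨x, hx⟩ := (Measure.ae_ae_of_ae_compProd hae).exists
    have h1 : κ x {y₁ | y₁ ≠ quantileFn ν (cdf μ x)} = 0 := hx
    rw [hatom] at h1
    exact one_ne_zero h1
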